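/- **Theorem (convergence of the double-loop block-coordinate proximal gradient method with extrapolation).** *Problem.* Let $\mathcal X_{i,j}$ ($1\le i\le N$, $1\le j\le R_i$) be finite-dimensional Euclidean spaces, $\mathcal X_i=\mathcal X_{i,1}\times\cdots\times\mathcal X_{i,R_i}$ and $\mathcal X=\mathcal X_1\times\cdots\times\mathcal X_N$ with the Euclidean product norms. Let $f:\mathcal X\to\mathbb R$ be continuously differentiable and, for each $i$, let $r_i(X_i)=\sum_{j=1}^{R_i} r_{i,j}(x_{i,j})$ be a proper lower semicontinuous extended-real-valued function (neither $f$ nor $r_i$ need be convex). Put $F(X)=f(X)+\sum_{i=1}^N r_i(X_i)$. *Inner routine.* Let $\ell_i=\ell_i\big((X_p)_{p\ne i}\big)\ge 0$ be moduli as in (ii) below. For $\varepsilon>0$, an integer $m_i>0$, a starting block $X_i$ and frozen blocks $Z_p$ ($p\neq i$), a value of $\mathrm{sub}(X_i,Z_{<i},Z_{>i},m_i,\varepsilon)$ is any $X_i^{m_i+1}$ obtained from $X_i^{0}=X_i$ by, for $v=0,\dots,m_i$ and $j=1,\dots,R_i$, $$x_{i,j}^{v+1}\in \operatorname{prox}^{r_{i,j}}_{1/(\varepsilon+l_{i,j}^{v})}\Big(x_{i,j}^{v}-\tfrac1{\varepsilon+l_{i,j}^{v}}\nabla_{x_{i,j}}f\big(Z_{<i},(x_{i,q}^{v+1})_{q<j},(x_{i,q}^{v})_{q\ge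 j},Z_{>i}\big)\Big),$$ where $\operatorname{prox}^{g}_{s}(z)=\arg\min_x\{g(x)+\frac1{2s}\|x-z\|^2\}$ (a set), and $l_{i,j}^v$ is a Lipschitz constant of $t\mapsto\nabla_{x_{i,j}}f(Z_{<i},(x_{i,q}^{v+1})_{q<j},t,(x_{i,q}^{v})_{q>j},Z_{>i})$ with $l_{i,j}^v\le \ell_i\big((Z_p)_{p\neq i}\big)$ (for instance the least Lipschitz constant). *Algorithm.* Let $X^0\in\mathcal X$, let $(w_k)_{k\ge0}$ be a non-decreasing sequence of positive reals with $\sup_k w_k<1$, let $m_1,\dots,m_N>0$ be integers, $\varepsilon>0$, $\tau=\varepsilon/\max_i m_i$, and $\overline X^0=X^0$. For $k=0,1,2,\dots$: 1. For $i=1,\dots,N$ let $Y_i^{k+1}$ be a value of $\mathrm{sub}(X_i^k,\widetilde X_{<i}^{k+1},\overline X_{>i}^{k},m_i,\varepsilon)$ and $\widetilde X_i^{k+1}=Y_i^{k+1}+w_k(Y_i^{k+1}-\overline X_i^k)$. 2. If $F(Y^{k+1})>F(X^k)-\frac\tau2\|Y^{k+1}-X^k\|^2$, then for $i=1,\dots,N$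 let $X_i^{k+1}$ be a value of $\mathrm{sub}(X_i^k,X_{<i}^{k+1},X_{>i}^{k},m_i,\varepsilon)$ and $\overline X_i^{k+1}=X_i^{k+1}+w_k(X_i^{k+1}-\overline X_i^k)$. Otherwise let $X^{k+1}=Y^{k+1}$ and $\overline X^{k+1}=\widetilde X^{k+1}$. *Assumptions.* (i) $\inf f>-\infty$ and $\inf r_i>-\infty$ for all $i$. (ii) For all $i$ and all fixed $(X_p)_{p\neq i}$, the map $X_i\mapsto\nabla_{X_i}f(X_1,\dots,X_N)$ is globally Lipschitz with modulus $\ell_i\big((X_p)_{p\ne i}\big)$. (iii) For each $i$ there is $l_i^+$ such that, for every $k$, the modulus $\ell_i$ at the frozen blocks used in the call that produced $X_i^{k+1}$ is at most $l_i^+$; these blocks are $(X_{<i}^{k+1},X_{>i}^k)$ if the test in step 2 holds at iteration $k$, and $(\widetilde X_{<i}^{k+1},\overline X_{>i}^k)$ otherwise. (iv) $\nabla f$ is Lipschitz continuous on every bounded subset of $\mathcal X$. *Conclusion.* Every accumulation point $X^*$ of $(X^k)_{k\in\mathbb N}$ is a stationary point of $\min F$, that is, $F(X^*)$ is finite and $0\in\partial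 F(X^*)$, where $\partial F$ is the limiting subdifferential: $v\in\partial F(x)$ iff there are $x_n\to x$ with $F(x_n)\to F(x)$ and $v_n\to v$ with $F(x_n)$ finite and $F(y)\ge F(x_n)+\langle v_n,y-x_n\rangle+o(\|y-x_n\|)$ as $y\to x_n$, for every $n$. -/

import Mathlib

open Set Filter Topology
open scoped NNReal

universe u

noncomputable section

/-! ### Variational notions on a finite-dimensional Euclidean space -/

section Variational

variable {V : Type u} [NormedAddCommGroup V] [InnerProductSpace ℝ V]

/-- The gradient of a real function on a finite-dimensional inner product space
(Mathlib's `gradient`; completeness is automatic in finite dimension). -/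
def euclGrad [FiniteDimensional ℝ V] (f : V → ℝ) (x : V) : V :=
  haveI : CompleteSpace V := FiniteDimensional.complete ℝ V
  gradient f x

/-- A proper extended-real-valued function: never `-∞` and not identically `+∞`. -/
def ProperFun {α : Type u} (g : α → EReal) : Prop :=
  (∀ x, g x ≠ ⊥) ∧ ∃ x, g x ≠ ⊤

/-- The (set-valued) proximal mapping `prox^g_s(z) = argmin_x { g x + ‖x - z‖² / (2 s) }`. -/
def proxSet (g : V → EReal) (s : ℝ) (z : V) : Set V :=
  {x | ∀ y, g x + ((‖x - z‖ ^ 2 / (2 * s) : ℝ) : EReal)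
      ≤ g y + ((‖y - z‖ ^ 2 / (2 * s) : ℝ) : EReal)}

/-- `v` is a regular (Fréchet) subgradient of `F` at `x`: `F x` is finite and
`F y ≥ F x + ⟪v, y - x⟫ + o(‖y - x‖)` as `y → x`. -/
def IsRegularSubgradient (F : V → EReal) (x v : V) : Prop :=
  F x ≠ ⊥ ∧ F x ≠ ⊤ ∧
    ∀ δ : ℝ, 0 < δ → ∀ᶠ y in 𝓝 x,
      F x + ((inner ℝ v (y - x) - δ * ‖y - x‖ : ℝ) : EReal) ≤ F y

/-- The limiting (Mordukhovich) subdifferential of `F` at `x`: `F x` is finite and `v` is the limit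
of regular subgradients at points `x_n → x` with `F x_n → F x`. -/
def limitingSubdifferential (F : V → EReal) (x : V) : Set V :=
  {v | F x ≠ ⊥ ∧ F x ≠ ⊤ ∧ ∃ (xs vs : ℕ → V),
      Tendsto xs atTop (𝓝 x) ∧ Tendsto (fun n => F (xs n)) atTop (𝓝 (F x)) ∧
      (∀ n, IsRegularSubgradient F (xs n) (vs n)) ∧ Tendsto vs atTop (𝓝 v)}

/-- A stationary point of `min F`. -/
def IsStationaryPoint (F : V → EReal) (x : V) : Prop :=
  (0 : V) ∈ limitingSubdifferential F x

end Variational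

/-! ### The block structure and the objective -/

section Blocks

variable {N : ℕ} {R : Fin N → ℕ}

/-- The Euclidean product space `𝒳_i = 𝒳_{i,1} × ⋯ × 𝒳_{i,R_i}`. -/
abbrev Block (E : (i : Fin N) → Fin (R i) → Type u) (i : Fin N) : Type u :=
  PiLp 2 (fun j : Fin (R i) => E i j)

/-- The Euclidean product space `𝒳 = 𝒳_1 × ⋯ × 𝒳_N`. -/
abbrev FullSpace (E : (i : Fin N) → Fin (R i) → Type u) : Type u :=
  PiLp 2 (fun i : Fin N => Block E i)

variable {E : (i : Fin N) → Fin (R i) → Type u}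

/-- `Z` with its `i`-th block replaced by `x`. -/
def setBlock (Z : FullSpace E) (i : Fin N) (x : Block E i) : FullSpace E :=
  WithLp.toLp 2 (Function.update (fun p => Z p) i x)

/-- `x` with its `j`-th sub-block replaced by `t`. -/
def setSubBlock {i : Fin N} (x : Block E i) (j : Fin (R i)) (t : E i j) : Block E i :=
  WithLp.toLp 2 (Function.update (fun q => x q) j t)

/-- The point `(A_{<i}, B_{≥ i})`. -/
def splice (i : Fin N) (A B : FullSpace E) : FullSpace E :=
  WithLp.toLp 2 (fun p => if p < i then A p else B p)

/-- The point `(a_{i,<j}, b_{i,≥ j})` of the `i`-th block space. -/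
def subSplice {i : Fin N} (j : Fin (R i)) (a b : Block E i) : Block E i :=
  WithLp.toLp 2 (fun q => if q < j then a q else b q)

/-- The tuple `(Z_p)_{p ≠ i}`. -/
def others (i : Fin N) (Z : FullSpace E) : (p : {p : Fin N // p ≠ i}) → Block E p.1 :=
  fun p => Z p.1

/-- The block-separable function `r_i(x) = ∑_j r_{i,j}(x_j)`. -/
def blockReg (r : (i : Fin N) → (j : Fin (R i)) → E i j → EReal) (i : Fin N)
    (x : Block E i) : EReal :=
  ∑ j, r i j (x j)

/-- The objective `F(X) = f(X) + ∑_i r_i(X_i)`. -/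
def objective (f : FullSpace E → ℝ) (r : (i : Fin N) → (j : Fin (R i)) → E i j → EReal)
    (X : FullSpace E) : EReal :=
  (f X : EReal) + ∑ i, blockReg r i (X i)

variable [∀ i j, NormedAddCommGroup (E i j)] [∀ i j, InnerProductSpace ℝ (E i j)]
  [∀ i j, FiniteDimensional ℝ (E i j)]

/-- The partial gradient `∇_{X_i} f`. -/
def blockGrad (f : FullSpace E → ℝ) (i : Fin N) (X : FullSpace E) : Block E i :=
  (euclGrad f X) i

/-- The partial gradient `∇_{x_{i,j}} f`. -/
def subBlockGrad (f : FullSpace E → ℝ) (i : Fin N) (j : Fin (R i)) (X : FullSpace E) : E i j :=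
  (blockGrad f i X) j

/-- Every `∇_{X_i} f`, as a function of `X_i` with the other blocks fixed, is globally Lipschitz
with a modulus `ℓ i (X_p)_{p ≠ i}` that may depend on those other blocks. -/
def HasBlockLipschitzModuli (f : FullSpace E → ℝ)
    (ℓ : (i : Fin N) → ((p : {p : Fin N // p ≠ i}) → Block E p.1) → ℝ≥0) : Prop :=
  ∀ (i : Fin N) (Z : FullSpace E),
    LipschitzWith (ℓ i (others i Z)) (fun x : Block E i => blockGrad f i (setBlock Z i x))

/-! ### The two algorithms

Proximal mappings are set-valued, so both algorithms are relations: a predicate says that the given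
points are a possible outcome. -/

/-- `xOut` is a possible value of `sub_BC_PGD`, started from `xIn` in the `i`-th block space with the
blocks `(Z_p)_{p ≠ i}` frozen (the `i`-th block of `Z` plays no role). The points `x v` are the
inner iterates `X_i^{k,v}`, `v = 0, …, mi + 1`, and `l v j` is the Lipschitz constant
`l_{i,j}^{k,v}` of the gradient in the sub-block `j` that is being updated, the other sub-blocks
being fixed at their current values; it does not exceed the modulus of the whole partial gradient
`∇_{X_i} f`. In particular the least Lipschitz constant may be used, and so may the modulus. -/
def IsSubBCPGD (f : FullSpace E → ℝ) (r : (i : Fin N) → (j : Fin (R i)) → E i j → EReal)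
    (ℓ : (i : Fin N) → ((p : {p : Fin N // p ≠ i}) → Block E p.1) → ℝ≥0)
    (ε : ℝ) (mi : ℕ) (i : Fin N) (Z : FullSpace E) (xIn xOut : Block E i) : Prop :=
  ∃ (x : ℕ → Block E i) (l : ℕ → Fin (R i) → ℝ≥0),
    x 0 = xIn ∧ x (mi + 1) = xOut ∧
    ∀ v ≤ mi, ∀ j : Fin (R i),
      LipschitzWith (l v j) (fun t : E i j =>
        subBlockGrad f i j (setBlock Z i (setSubBlock (subSplice j (x (v + 1)) (x v)) j t))) ∧
      l v j ≤ ℓ i (others i Z) ∧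
      x (v + 1) j ∈ proxSet (r i j) (1 / (ε + l v j))
        (x v j - (1 / (ε + l v j) : ℝ) •
          subBlockGrad f i j (setBlock Z i (subSplice j (x (v + 1)) (x v))))

/-- The parameter `τ = ε / max_i m_i`. -/
def tauParam (ε : ℝ) (m : Fin N → ℕ) : ℝ :=
  ε / ((Finset.univ.sup m : ℕ) : ℝ)

/-- The test that triggers the safeguard: the trial point `Y` does not decrease the objective
sufficiently, `F(Y) > F(X) - (τ/2) ‖Y - X‖²`. -/
def SafeguardTest (f : FullSpace E → ℝ) (r : (i : Fin N) → (j : Fin (R i)) → E i j → EReal)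
    (τ : ℝ) (X Y : FullSpace E) : Prop :=
  objective f r X - ((τ / 2 * ‖Y - X‖ ^ 2 : ℝ) : EReal) < objective f r Y

/-- The sequences `X` (iterates), `Xbar` (extrapolated points), `Y` (trial points, the values of
`X^{k+1}` before the test) and `Xtil` (extrapolated trial points, `Xtil k` standing for
the tilde point of index `k + 1`) are generated by the double-loop block-coordinate proximal
gradient method with extrapolation. -/
structure IsDoubleLoopRun (f : FullSpace E → ℝ)
    (r : (i : Fin N) → (j : Fin (R i)) → E i j → EReal)
    (ℓ : (i : Fin N) → ((p : {p : Fin N // p ≠ i}) → Block E p.1) → ℝ≥0)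
    (ε : ℝ) (m : Fin N → ℕ) (w : ℕ → ℝ) (X Xbar Y Xtil : ℕ → FullSpace E) : Prop where
  init : Xbar 0 = X 0
  /-- the sweep with extrapolated frozen blocks -/
  trial : ∀ k i, IsSubBCPGD f r ℓ ε (m i) i (splice i (Xtil k) (Xbar k)) (X k i) (Y k i)
  extrapolate : ∀ k i, Xtil k i = Y k i + w k • (Y k i - Xbar k i)
  /-- the sweep without extrapolation, run when the trial point fails the test -/
  safeguard : ∀ k, SafeguardTest f r (tauParam ε m) (X k) (Y k) → ∀ i,
    IsSubBCPGD f r ℓ ε (m i) i (splice i (X (k + 1)) (X k)) (X k i) (X (k + 1) i) ∧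
    Xbar (k + 1) i = X (k + 1) i + w k • (X (k + 1) i - Xbar k i)
  accept : ∀ k, ¬ SafeguardTest f r (tauParam ε m) (X k) (Y k) →
    X (k + 1) = Y k ∧ Xbar (k + 1) = Xtil k

open Classical in
/-- The frozen blocks in the call of `sub_BC_PGD` that produced `X_i^{k+1}`: `X_{<i}^{k+1}` and
`X_{>i}^k` if the safeguard was triggered, the extrapolated blocks otherwise. -/
def frozenBlocks (f : FullSpace E → ℝ) (r : (i : Fin N) → (j : Fin (R i)) → E i j → EReal)
    (ε : ℝ) (m : Fin N → ℕ) (X Xbar Y Xtil : ℕ → FullSpace E) (k : ℕ) (i : Fin N) :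
    (p : {p : Fin N // p ≠ i}) → Block E p.1 :=
  if SafeguardTest f r (tauParam ε m) (X k) (Y k)
    then others i (splice i (X (k + 1)) (X k))
    else others i (splice i (Xtil k) (Xbar k))

end Blocks

end

/-! ### Finite sums of extended reals -/

section ERealSums

theorem EReal.finsetSum_eq_bot_iff {ι : Type*} (s : Finset ι) (g : ι → EReal) :
    ∑ i ∈ s, g i = ⊥ ↔ ∃ i ∈ s, g i = ⊥ := by
  classical
  induction s using Finset.induction_on with
  | empty => simp
  | insert a s ha ih => simp [Finset.sum_insert ha, EReal.add_eq_bot_iff, ih]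

theorem EReal.finsetSum_ne_top {ι : Type*} (s : Finset ι) (g : ι → EReal)
    (h : ∀ i ∈ s, g i ≠ ⊤) : ∑ i ∈ s, g i ≠ ⊤ := by
  classical
  induction s using Finset.induction_on with
  | empty => simp
  | insert a s ha ih =>
    rw [Finset.sum_insert ha]
    exact EReal.add_ne_top (h a (by simp)) (ih fun i hi => h i (by simp [hi]))

theorem EReal.ne_top_of_finsetSum_ne_top {ι : Type*} (s : Finset ι) (g : ι → EReal)
    (hbot : ∀ i ∈ s, g i ≠ ⊥) (h : ∑ i ∈ s, g i ≠ ⊤) : ∀ i ∈ s, g i ≠ ⊤ := by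
  classical
  intro i hi htop
  rw [← Finset.add_sum_erase s g hi, htop] at h
  refine h (EReal.top_add_of_ne_bot ?_)
  rw [Ne, EReal.finsetSum_eq_bot_iff]
  rintro ⟨p, hp, hpb⟩
  exact hbot p (Finset.mem_of_mem_erase hp) hpb

theorem EReal.finsetSum_eq_coe {ι : Type*} (s : Finset ι) (g : ι → EReal)
    (hbot : ∀ i ∈ s, g i ≠ ⊥) (htop : ∀ i ∈ s, g i ≠ ⊤) :
    ∑ i ∈ s, g i = ((∑ i ∈ s, (g i).toReal : ℝ) : EReal) := by
  classical
  induction s using Finset.induction_on with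
  | empty => simp
  | insert a s ha ih =>
    rw [Finset.sum_insert ha, Finset.sum_insert ha, EReal.coe_add,
      ih (fun i hi => hbot i (by simp [hi])) (fun i hi => htop i (by simp [hi])),
      EReal.coe_toReal (htop a (by simp)) (hbot a (by simp))]

end ERealSums

/-! ### Proximal steps and smooth functions with Lipschitz gradient -/

section Prox

theorem proxSet_ne_top {V : Type u} [NormedAddCommGroup V] {g : V → EReal}
    (hfin : ∃ x, g x ≠ ⊤) {s : ℝ} {z x : V} (hx : x ∈ proxSet g s z) : g x ≠ ⊤ := by
  obtain ⟨y, hy⟩ := hfin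
  intro h
  have h1 := hx y
  rw [h, EReal.top_add_coe, top_le_iff] at h1
  exact EReal.add_ne_top hy (EReal.coe_ne_top _) h1

variable {V : Type u} [NormedAddCommGroup V] [InnerProductSpace ℝ V]

/-- The optimality of a proximal gradient step, with the square completed. -/
theorem proxSet_step_le {g : V → EReal} (hbot : ∀ x, g x ≠ ⊥) {c : ℝ} (hc : 0 < c)
    {u G x t : V} (hx : x ∈ proxSet g (1 / c) (u - (1 / c : ℝ) • G)) (hgx : g x ≠ ⊤)
    (hgt : g t ≠ ⊤) :
    (g x).toReal + inner ℝ G (x - u) + c / 2 * ‖x - u‖ ^ 2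
      ≤ (g t).toReal + inner ℝ G (t - u) + c / 2 * ‖t - u‖ ^ 2 := by
  have h := hx t
  rw [← EReal.coe_toReal hgx (hbot x), ← EReal.coe_toReal hgt (hbot t), ← EReal.coe_add,
    ← EReal.coe_add, EReal.coe_le_coe_iff] at h
  have key : ∀ y : V, ‖y - (u - (1 / c : ℝ) • G)‖ ^ 2 / (2 * (1 / c))
      = c / 2 * ‖y - u‖ ^ 2 + inner ℝ G (y - u) + ‖G‖ ^ 2 / (2 * c) := by
    intro y
    have e : y - (u - (1 / c : ℝ) • G) = (y - u) + (1 / c : ℝ) • G := by abel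
    rw [e, norm_add_sq_real, inner_smul_right, norm_smul, real_inner_comm, mul_pow,
      Real.norm_eq_abs, sq_abs]
    field_simp
  rw [key, key] at h
  linarith

/-- The descent lemma. -/
theorem descent_lemma {φ : V → ℝ} {g : V → V} {L : ℝ≥0} (hL : LipschitzWith L g) (a b : V)
    (hg : ∀ s : ℝ, HasDerivAt (fun s : ℝ => φ (a + s • (b - a)))
      (inner ℝ (g (a + s • (b - a))) (b - a)) s) :
    φ b ≤ φ a + inner ℝ (g a) (b - a) + L / 2 * ‖b - a‖ ^ 2 := by
  set d := b - a with hd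
  let ψ : ℝ → ℝ := fun s => φ (a + s • d) - s * inner ℝ (g a) d - L / 2 * s ^ 2 * ‖d‖ ^ 2
  have hψ : ∀ s, HasDerivAt ψ
      (inner ℝ (g (a + s • d)) d - inner ℝ (g a) d - L * s * ‖d‖ ^ 2) s := by
    intro s
    have h1 := ((hg s).sub ((hasDerivAt_id s).mul_const (inner ℝ (g a) d))).sub
      ((((hasDerivAt_id s).pow 2).const_mul ((L : ℝ) / 2)).mul_const (‖d‖ ^ 2))
    refine HasDerivAt.congr_deriv (f := ψ) h1 ?_
    simp only [id, Nat.cast_ofNat]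
    ring
  have hanti : AntitoneOn ψ (Icc 0 1) := by
    refine antitoneOn_of_deriv_nonpos (convex_Icc 0 1)
      (fun s _ => (hψ s).continuousAt.continuousWithinAt)
      (fun s _ => (hψ s).differentiableAt.differentiableWithinAt) ?_
    intro s hs
    rw [interior_Icc] at hs
    rw [(hψ s).deriv, ← inner_sub_left]
    have h2 : ‖g (a + s • d) - g a‖ ≤ L * (s * ‖d‖) := by
      have := hL.norm_sub_le (a + s • d) a
      rwa [add_sub_cancel_left, norm_smul, Real.norm_eq_abs, abs_of_pos hs.1] at this
    have h3 := real_inner_le_norm (g (a + s • d) - g a) d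
    nlinarith [mul_le_mul_of_nonneg_right h2 (norm_nonneg d)]
  have h := hanti (left_mem_Icc.2 zero_le_one) (right_mem_Icc.2 zero_le_one) zero_le_one
  simp only [ψ, one_smul, zero_smul, add_zero, hd] at h
  rw [add_sub_cancel] at h
  linarith

end Prox

/-! ### Telescoping over the coordinates of a product -/

section Telescoping

theorem sum_update_splice {n : ℕ} {α : Fin n → Type*} (h : (∀ q, α q) → ℝ) (a b : ∀ q, α q) :
    ∑ j : Fin n, (h (Function.update (fun q => if q < j then a q else b q) j (a j))
      - h (fun q => if q < j then a q else b q)) = h a - h b := by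
  let P : ℕ → ∀ q, α q := fun k q => if q.val < k then a q else b q
  have h1 : ∀ j : Fin n, (h (Function.update (fun q => if q < j then a q else b q) j (a j))
      - h (fun q => if q < j then a q else b q)) = h (P (j.val + 1)) - h (P j.val) := by
    intro j
    have e1 : Function.update (fun q => if q < j then a q else b q) j (a j) = P (j.val + 1) := by
      funext q
      by_cases hq : q = j
      · subst hq; simp [P]
      · have : q.val ≠ j.val := fun h => hq (Fin.ext h)
        have : q < j ↔ q.val < j.val + 1 := by rw [Fin.lt_def]; omega
        simp [P, Function.update_of_ne hq, this]
    rw [e1]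
    rfl
  rw [Finset.sum_congr rfl fun j _ => h1 j,
    Fin.sum_univ_eq_sum_range (fun k => h (P (k + 1)) - h (P k)) n,
    Finset.sum_range_sub (fun k => h (P k))]
  have e0 : P 0 = b := by funext q; simp [P]
  have en : P n = a := by funext q; simp [P]
  rw [e0, en]

end Telescoping

/-! ### Partial gradients -/

section Blocks

variable {N : ℕ} {R : Fin N → ℕ} {E : (i : Fin N) → Fin (R i) → Type u}

theorem setBlock_self (Z : FullSpace E) (i : Fin N) (x : Block E i) : setBlock Z i x i = x := by
  simp [setBlock]

theorem setBlock_of_ne (Z : FullSpace E) {i p : Fin N} (h : p ≠ i) (x : Block E i) :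
    setBlock Z i x p = Z p := by
  simp [setBlock, h]

theorem setSubBlock_self {i : Fin N} (x : Block E i) (j : Fin (R i)) (t : E i j) :
    setSubBlock x j t j = t := by
  simp [setSubBlock]

theorem setSubBlock_of_ne {i : Fin N} (x : Block E i) {j q : Fin (R i)} (h : q ≠ j) (t : E i j) :
    setSubBlock x j t q = x q := by
  simp [setSubBlock, h]

theorem setSubBlock_eq_self {i : Fin N} (x : Block E i) (j : Fin (R i)) :
    setSubBlock x j (x j) = x := by
  simp [setSubBlock]

theorem setBlock_eq_self (Z : FullSpace E) (i : Fin N) : setBlock Z i (Z i) = Z := by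
  simp [setBlock]

theorem subSplice_self {i : Fin N} (j : Fin (R i)) (a b : Block E i) : subSplice j a b j = b j := by
  simp [subSplice]

theorem splice_self (i : Fin N) (A B : FullSpace E) : splice i A B i = B i := by
  simp [splice]

theorem sum_setSubBlock_subSplice {i : Fin N} (h : Block E i → ℝ) (a b : Block E i) :
    ∑ j, (h (setSubBlock (subSplice j a b) j (a j)) - h (subSplice j a b)) = h a - h b :=
  sum_update_splice (fun x : ∀ j, E i j => h (WithLp.toLp 2 x)) (fun j => a j) (fun j => b j)

theorem sum_setBlock_splice (h : FullSpace E → ℝ) (A B : FullSpace E) :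
    ∑ i, (h (setBlock (splice i A B) i (A i)) - h (splice i A B)) = h A - h B :=
  sum_update_splice (fun x : ∀ i, Block E i => h (WithLp.toLp 2 x)) (fun i => A i) (fun i => B i)

variable [∀ i j, NormedAddCommGroup (E i j)] [∀ i j, InnerProductSpace ℝ (E i j)]
  [∀ i j, FiniteDimensional ℝ (E i j)]

theorem hasFDerivAt_euclGrad {V : Type u} [NormedAddCommGroup V] [InnerProductSpace ℝ V]
    [FiniteDimensional ℝ V] {f : V → ℝ} {x : V} (hf : DifferentiableAt ℝ f x) :
    HasFDerivAt f (innerSL ℝ (euclGrad f x)) x := by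
  have : CompleteSpace V := FiniteDimensional.complete ℝ V
  exact hf.hasGradientAt.hasFDerivAt

theorem continuous_euclGrad {V : Type u} [NormedAddCommGroup V] [InnerProductSpace ℝ V]
    [FiniteDimensional ℝ V] {f : V → ℝ} (hf : ContDiff ℝ 1 f) : Continuous (euclGrad f) := by
  have : CompleteSpace V := FiniteDimensional.complete ℝ V
  exact (InnerProductSpace.toDual ℝ V).symm.continuous.comp (hf.continuous_fderiv one_ne_zero)

theorem hasDerivAt_subBlock_line {f : FullSpace E → ℝ} (hf : Differentiable ℝ f) (Z : FullSpace E)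
    (i : Fin N) (b : Block E i) (j : Fin (R i)) (t d : E i j) (s : ℝ) :
    HasDerivAt (fun s : ℝ => f (setBlock Z i (setSubBlock b j (t + s • d))))
      (inner ℝ (subBlockGrad f i j (setBlock Z i (setSubBlock b j (t + s • d)))) d) s := by
  let D : FullSpace E := setBlock 0 i (setSubBlock 0 j d)
  let A : FullSpace E := setBlock Z i (setSubBlock b j t)
  have e : ∀ s : ℝ, setBlock Z i (setSubBlock b j (t + s • d)) = A + s • D := by
    intro s
    ext p q
    by_cases hp : p = i
    · subst hp
      by_cases hq : q = j
      · subst hq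
        simp [A, D, setBlock_self, setSubBlock_self]
      · simp [A, D, setBlock_self, setSubBlock_of_ne _ hq]
    · simp [A, D, setBlock_of_ne _ hp]
  have hD : ∀ G : FullSpace E, inner ℝ G D = inner ℝ (G i j) d := by
    intro G
    rw [PiLp.inner_apply, Finset.sum_eq_single i, PiLp.inner_apply, Finset.sum_eq_single j]
    · simp [D, setBlock_self, setSubBlock_self]
    · intro q _ hq
      simp [D, setBlock_self, setSubBlock_of_ne _ hq]
    · simp
    · intro p _ hp
      simp [D, setBlock_of_ne _ hp]
    · simp
  simp only [e]
  have hl : HasDerivAt (fun s : ℝ => A + s • D) D s := by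
    simpa using ((hasDerivAt_id s).smul_const D).const_add A
  have h := (hasFDerivAt_euclGrad (hf (A + s • D))).comp_hasDerivAt s hl
  rw [innerSL_apply_apply, hD] at h
  exact h

/-! ### Separable regularizers -/

/-- The sum of the real values of the regularizers on the `i`-th block. -/
noncomputable def regVal (r : (i : Fin N) → (j : Fin (R i)) → E i j → EReal) (i : Fin N)
    (x : Block E i) : ℝ :=
  ∑ j, (r i j (x j)).toReal

end Blocks

section Regularizers

variable {N : ℕ} {R : Fin N → ℕ} {E : (i : Fin N) → Fin (R i) → Type u}
  {r : (i : Fin N) → (j : Fin (R i)) → E i j → EReal}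

theorem ProperFun.sub_ne_bot {i : Fin N} (h : ProperFun (blockReg r i)) (j : Fin (R i))
    (t : E i j) : r i j t ≠ ⊥ := by
  obtain ⟨x, -⟩ := h.2
  intro hb
  apply h.1 (setSubBlock x j t)
  rw [blockReg, EReal.finsetSum_eq_bot_iff]
  exact ⟨j, Finset.mem_univ j, by rw [setSubBlock_self, hb]⟩

theorem ProperFun.exists_sub_ne_top {i : Fin N} (h : ProperFun (blockReg r i)) (j : Fin (R i)) :
    ∃ t, r i j t ≠ ⊤ := by
  obtain ⟨x, hx⟩ := h.2
  exact ⟨x j, EReal.ne_top_of_finsetSum_ne_top _ _ (fun q _ => h.sub_ne_bot q (x q)) hx j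
    (Finset.mem_univ j)⟩

theorem blockReg_ne_top_iff {i : Fin N} (h : ProperFun (blockReg r i)) (x : Block E i) :
    blockReg r i x ≠ ⊤ ↔ ∀ j, r i j (x j) ≠ ⊤ :=
  ⟨fun hx j => EReal.ne_top_of_finsetSum_ne_top _ _ (fun q _ => h.sub_ne_bot q (x q)) hx j
    (Finset.mem_univ j), fun hx => EReal.finsetSum_ne_top _ _ fun j _ => hx j⟩

theorem blockReg_eq_coe {i : Fin N} (h : ProperFun (blockReg r i)) {x : Block E i}
    (hx : ∀ j, r i j (x j) ≠ ⊤) : blockReg r i x = (regVal r i x : EReal) :=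
  EReal.finsetSum_eq_coe _ _ (fun j _ => h.sub_ne_bot j (x j)) fun j _ => hx j

theorem objective_ne_bot (h : ∀ i, ProperFun (blockReg r i)) (f : FullSpace E → ℝ)
    (X : FullSpace E) : objective f r X ≠ ⊥ := by
  rw [objective, Ne, EReal.add_eq_bot_iff, EReal.finsetSum_eq_bot_iff]
  rintro (h1 | ⟨i, -, h1⟩)
  · exact EReal.coe_ne_bot _ h1
  · exact (h i).1 _ h1

theorem objective_ne_top_iff (h : ∀ i, ProperFun (blockReg r i)) (f : FullSpace E → ℝ)
    (X : FullSpace E) : objective f r X ≠ ⊤ ↔ ∀ i j, r i j (X i j) ≠ ⊤ := by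
  constructor
  · intro hX i
    have h1 : ∑ i, blockReg r i (X i) ≠ ⊤ := by
      intro h2
      rw [objective, h2, EReal.coe_add_top] at hX
      exact hX rfl
    exact (blockReg_ne_top_iff (h i) _).1
      (EReal.ne_top_of_finsetSum_ne_top _ _ (fun p _ => (h p).1 _) h1 i (Finset.mem_univ i))
  · intro hX
    exact EReal.add_ne_top (EReal.coe_ne_top _)
      (EReal.finsetSum_ne_top _ _ fun i _ => (blockReg_ne_top_iff (h i) _).2 (hX i))

theorem objective_eq_coe (h : ∀ i, ProperFun (blockReg r i)) (f : FullSpace E → ℝ)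
    {X : FullSpace E} (hX : ∀ i j, r i j (X i j) ≠ ⊤) :
    objective f r X = ((f X + ∑ i, regVal r i (X i) : ℝ) : EReal) := by
  rw [objective, EReal.finsetSum_eq_coe _ _ (fun i _ => (h i).1 _)
    (fun i _ => (blockReg_ne_top_iff (h i) _).2 (hX i)), EReal.coe_add]
  have e : ∀ i, (blockReg r i (X i)).toReal = regVal r i (X i) := fun i => by
    rw [blockReg_eq_coe (h i) (hX i), EReal.toReal_coe]
  simp only [e]

end Regularizers

/-! ### The inner routine -/

section Inner

variable {N : ℕ} {R : Fin N → ℕ} {E : (i : Fin N) → Fin (R i) → Type u}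
  [∀ i j, NormedAddCommGroup (E i j)] [∀ i j, InnerProductSpace ℝ (E i j)]
  [∀ i j, FiniteDimensional ℝ (E i j)]

theorem norm_sub_sq_le_card_mul_sum {V : Type*} [SeminormedAddCommGroup V] (x : ℕ → V) (n : ℕ) :
    ‖x n - x 0‖ ^ 2 ≤ n * ∑ v ∈ Finset.range n, ‖x (v + 1) - x v‖ ^ 2 := by
  rw [← Finset.sum_range_sub x n]
  calc ‖∑ v ∈ Finset.range n, (x (v + 1) - x v)‖ ^ 2
      ≤ (∑ v ∈ Finset.range n, ‖x (v + 1) - x v‖) ^ 2 := by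
        gcongr
        exact norm_sum_le _ _
    _ ≤ n * ∑ v ∈ Finset.range n, ‖x (v + 1) - x v‖ ^ 2 := by
        simpa using sq_sum_le_card_mul_sum_sq (s := Finset.range n)
          (f := fun v => ‖x (v + 1) - x v‖)

/-- One sweep of proximal gradient steps over the sub-blocks of a block decreases the objective. -/
theorem sweep_decrease {f : FullSpace E → ℝ} (hf : Differentiable ℝ f)
    {r : (i : Fin N) → (j : Fin (R i)) → E i j → EReal} {ε : ℝ} (hε : 0 < ε) {i : Fin N}
    (hr : ProperFun (blockReg r i)) {Z : FullSpace E} {a b : Block E i} {l : Fin (R i) → ℝ≥0}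
    (hL : ∀ j, LipschitzWith (l j) (fun t : E i j =>
      subBlockGrad f i j (setBlock Z i (setSubBlock (subSplice j a b) j t))))
    (hp : ∀ j, a j ∈ proxSet (r i j) (1 / (ε + l j)) (b j - (1 / (ε + l j) : ℝ) •
      subBlockGrad f i j (setBlock Z i (subSplice j a b))))
    (ha : ∀ j, r i j (a j) ≠ ⊤) (hb : ∀ j, r i j (b j) ≠ ⊤) :
    f (setBlock Z i a) + regVal r i a + ε / 2 * ‖a - b‖ ^ 2
      ≤ f (setBlock Z i b) + regVal r i b := by
  have key : ∀ j, (f (setBlock Z i (setSubBlock (subSplice j a b) j (a j)))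
      - f (setBlock Z i (subSplice j a b))) + (r i j (a j)).toReal
      + ε / 2 * ‖(a - b) j‖ ^ 2 ≤ (r i j (b j)).toReal := by
    intro j
    have h1 := descent_lemma (φ := fun t => f (setBlock Z i (setSubBlock (subSplice j a b) j t)))
      (hL j) (b j) (a j) (fun s => hasDerivAt_subBlock_line hf Z i _ j _ _ s)
    have h2 := proxSet_step_le (fun t => hr.sub_ne_bot j t) (by positivity) (hp j) (ha j) (hb j)
    have e : setSubBlock (subSplice j a b) j (b j) = subSplice j a b := by
      conv_lhs => rw [← subSplice_self j a b]
      exact setSubBlock_eq_self _ _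
    rw [e] at h1
    simp only [sub_self, inner_zero_right, norm_zero] at h2
    rw [PiLp.sub_apply]
    linarith
  have hs := Finset.sum_le_sum fun j (_ : j ∈ Finset.univ) => key j
  rw [Finset.sum_add_distrib, Finset.sum_add_distrib, ← Finset.mul_sum,
    sum_setSubBlock_subSplice (fun x => f (setBlock Z i x)), ← PiLp.norm_sq_eq_of_L2] at hs
  unfold regVal
  linarith

/-- Outcome of the inner routine: the output is finite, it is a proximal gradient step from the last
inner iterate `u`, and the objective decreases. -/
theorem IsSubBCPGD.exists_last_step {f : FullSpace E → ℝ} (hf : Differentiable ℝ f)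
    {r : (i : Fin N) → (j : Fin (R i)) → E i j → EReal}
    {ℓ : (i : Fin N) → ((p : {p : Fin N // p ≠ i}) → Block E p.1) → ℝ≥0}
    {ε c : ℝ} (hε : 0 < ε) (hc : 0 ≤ c) {i : Fin N} {mi : ℕ} (hcm : c * (4 * (mi + 1)) ≤ ε)
    (hr : ProperFun (blockReg r i)) {Z : FullSpace E} {xIn xOut : Block E i}
    (h : IsSubBCPGD f r ℓ ε mi i Z xIn xOut) :
    (∀ j, r i j (xOut j) ≠ ⊤) ∧ ∃ (u : Block E i) (l : Fin (R i) → ℝ≥0),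
      (∀ j, l j ≤ ℓ i (others i Z) ∧ xOut j ∈ proxSet (r i j) (1 / (ε + l j))
        (u j - (1 / (ε + l j) : ℝ) •
          subBlockGrad f i j (setBlock Z i (subSplice j xOut u)))) ∧
      ((∀ j, r i j (xIn j) ≠ ⊤) →
        f (setBlock Z i xOut) + regVal r i xOut + c * ‖xOut - u‖ ^ 2 + c * ‖xOut - xIn‖ ^ 2
          ≤ f (setBlock Z i xIn) + regVal r i xIn) := by
  obtain ⟨x, l, rfl, rfl, hx⟩ := h
  have hfin : ∀ v ≤ mi, ∀ j, r i j (x (v + 1) j) ≠ ⊤ := fun v hv j =>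
    proxSet_ne_top (hr.exists_sub_ne_top j) (hx v hv j).2.2
  refine ⟨hfin mi le_rfl, x mi, l mi,
    fun j => ⟨(hx mi le_rfl j).2.1, (hx mi le_rfl j).2.2⟩, fun h0 => ?_⟩
  have hfin' : ∀ v ≤ mi, ∀ j, r i j (x v j) ≠ ⊤ := by
    intro v hv
    cases v with
    | zero => exact h0
    | succ v => exact hfin v (by omega)
  let Φ : ℕ → ℝ := fun v => f (setBlock Z i (x v)) + regVal r i (x v)
  have hstep : ∀ v ∈ Finset.range (mi + 1),
      ε / 2 * ‖x (v + 1) - x v‖ ^ 2 ≤ -(Φ (v + 1) - Φ v) := by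
    intro v hv
    have hv' : v ≤ mi := by simpa [Nat.lt_succ_iff] using hv
    have := sweep_decrease hf hε hr (fun j => (hx v hv' j).1) (fun j => (hx v hv' j).2.2)
      (hfin v hv') (hfin' v hv')
    simp only [Φ]
    linarith
  have hsum := Finset.sum_le_sum hstep
  rw [← Finset.mul_sum, Finset.sum_neg_distrib, Finset.sum_range_sub] at hsum
  set S := ∑ v ∈ Finset.range (mi + 1), ‖x (v + 1) - x v‖ ^ 2 with hS
  have h1 : ‖x (mi + 1) - x mi‖ ^ 2 ≤ S :=
    Finset.single_le_sum (f := fun v => ‖x (v + 1) - x v‖ ^ 2) (fun v _ => sq_nonneg _)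
      (Finset.self_mem_range_succ mi)
  have h2 := norm_sub_sq_le_card_mul_sum x (mi + 1)
  rw [← hS] at h2
  push_cast at h2
  have hS0 : 0 ≤ S := Finset.sum_nonneg fun v _ => sq_nonneg _
  have h3 : c * ‖x (mi + 1) - x mi‖ ^ 2 ≤ ε / 4 * S := by
    have : c ≤ ε / 4 := by nlinarith [mul_nonneg hc (Nat.cast_nonneg (α := ℝ) mi)]
    exact mul_le_mul this h1 (sq_nonneg _) (by positivity)
  have h4 : c * ‖x (mi + 1) - x 0‖ ^ 2 ≤ ε / 4 * S := by
    nlinarith [mul_le_mul_of_nonneg_left h2 hc, mul_le_mul_of_nonneg_right hcm hS0]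
  simp only [Φ] at hsum
  linarith

end Inner

/-! ### Limits of proximal gradient steps -/

section Limits

theorem proxSet_step_subgradient {V : Type u} [NormedAddCommGroup V] [InnerProductSpace ℝ V]
    {g : V → EReal} (hbot : ∀ x, g x ≠ ⊥) {c : ℝ} (hc : 0 < c)
    {u G x t : V} (hx : x ∈ proxSet g (1 / c) (u - (1 / c : ℝ) • G)) (hgx : g x ≠ ⊤)
    (hgt : g t ≠ ⊤) :
    (g x).toReal + inner ℝ (-G - c • (x - u)) (t - x) - c / 2 * ‖t - x‖ ^ 2 ≤ (g t).toReal := by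
  have h := proxSet_step_le hbot hc hx hgx hgt
  have e : t - u = (t - x) + (x - u) := by abel
  rw [e, norm_add_sq_real, inner_add_right, real_inner_comm (x - u) (t - x)] at h
  rw [inner_sub_left, inner_neg_left, real_inner_smul_left]
  linarith

variable {N : ℕ} {R : Fin N → ℕ} {E : (i : Fin N) → Fin (R i) → Type u}
  [∀ i j, NormedAddCommGroup (E i j)]

theorem tendsto_subBlock {ι : Type*} {F : Filter ι} {i : Fin N} {x : ι → Block E i} {xs : Block E i}
    (hx : Tendsto x F (𝓝 xs)) (j : Fin (R i)) : Tendsto (fun n => x n j) F (𝓝 (xs j)) :=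
  ((PiLp.continuous_apply 2 _ j).tendsto xs).comp hx

theorem tendsto_block {ι : Type*} {F : Filter ι} {x : ι → FullSpace E} {xs : FullSpace E}
    (hx : Tendsto x F (𝓝 xs)) (i : Fin N) : Tendsto (fun n => x n i) F (𝓝 (xs i)) :=
  ((PiLp.continuous_apply 2 _ i).tendsto xs).comp hx

theorem tendsto_piLp {ι κ : Type*} [Fintype κ] {β : κ → Type*} [∀ k, NormedAddCommGroup (β k)]
    {F : Filter ι} {x : ι → PiLp 2 β} {xs : PiLp 2 β}
    (h : ∀ k, Tendsto (fun n => x n k) F (𝓝 (xs k))) : Tendsto x F (𝓝 xs) :=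
  ((PiLp.continuous_toLp 2 β).tendsto _).comp (tendsto_pi_nhds.2 h)

theorem tendsto_setBlock {ι : Type*} {F : Filter ι} {Z : ι → FullSpace E} {Zs : FullSpace E}
    {i : Fin N} {x : ι → Block E i} (hZ : Tendsto Z F (𝓝 Zs)) (hx : Tendsto x F (𝓝 (Zs i))) :
    Tendsto (fun n => setBlock (Z n) i (x n)) F (𝓝 Zs) := by
  refine tendsto_piLp fun p => ?_
  by_cases hp : p = i
  · subst hp
    simpa only [setBlock_self] using hx
  · simpa only [setBlock_of_ne _ hp] using tendsto_block hZ p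

theorem tendsto_subSplice {ι : Type*} {F : Filter ι} {i : Fin N} {a b : ι → Block E i}
    {xs : Block E i} (ha : Tendsto a F (𝓝 xs)) (hb : Tendsto b F (𝓝 xs)) (j : Fin (R i)) :
    Tendsto (fun n => subSplice j (a n) (b n)) F (𝓝 xs) := by
  refine tendsto_piLp fun q => ?_
  by_cases hq : q < j
  · simpa [subSplice, hq] using tendsto_subBlock ha q
  · simpa [subSplice, hq] using tendsto_subBlock hb q

variable [∀ i j, InnerProductSpace ℝ (E i j)]

/-- Along proximal gradient steps with converging data, the regularizer converges to its value
at the limit point, which is finite. -/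
theorem tendsto_regVal_of_proxSet {r : (i : Fin N) → (j : Fin (R i)) → E i j → EReal} {ε : ℝ}
    (hε : 0 < ε) {i : Fin N} (hr : ProperFun (blockReg r i))
    (hlsc : LowerSemicontinuous (blockReg r i)) {L : ℝ≥0} {x u : ℕ → Block E i} {xs : Block E i}
    {G : ℕ → (j : Fin (R i)) → E i j} {Gs : (j : Fin (R i)) → E i j} {l : ℕ → Fin (R i) → ℝ≥0}
    (hx : Tendsto x atTop (𝓝 xs)) (hu : Tendsto u atTop (𝓝 xs))
    (hG : ∀ j, Tendsto (fun n => G n j) atTop (𝓝 (Gs j))) (hl : ∀ n j, l n j ≤ L)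
    (hp : ∀ n j, x n j ∈ proxSet (r i j) (1 / (ε + l n j))
      (u n j - (1 / (ε + l n j) : ℝ) • G n j)) :
    (∀ j, r i j (xs j) ≠ ⊤) ∧
      Tendsto (fun n => regVal r i (x n)) atTop (𝓝 (regVal r i xs)) := by
  have hfin : ∀ n j, r i j (x n j) ≠ ⊤ := fun n j =>
    proxSet_ne_top (hr.exists_sub_ne_top j) (hp n j)
  let e : Block E i → ℕ → ℝ := fun t n =>
    ∑ j, (‖G n j‖ * ‖t j - x n j‖ + (ε + L) / 2 * ‖t j - u n j‖ ^ 2)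
  have he : ∀ t, Tendsto (e t) atTop
      (𝓝 (∑ j, (‖Gs j‖ * ‖t j - xs j‖ + (ε + L) / 2 * ‖t j - xs j‖ ^ 2))) := by
    intro t
    refine tendsto_finsetSum _ fun j _ => ?_
    exact ((hG j).norm.mul ((tendsto_subBlock hx j).const_sub _).norm).add
      ((((tendsto_subBlock hu j).const_sub _).norm.pow 2).const_mul _)
  have hup : ∀ t : Block E i, (∀ j, r i j (t j) ≠ ⊤) → ∀ n,
      regVal r i (x n) ≤ regVal r i t + e t n := by
    intro t ht n
    simp only [regVal, e, ← Finset.sum_add_distrib]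
    refine Finset.sum_le_sum fun j _ => ?_
    have h1 := proxSet_step_le (fun t => hr.sub_ne_bot j t) (by positivity) (hp n j)
      (hfin n j) (ht j)
    have h2 : inner ℝ (G n j) (t j - u n j) - inner ℝ (G n j) (x n j - u n j)
        ≤ ‖G n j‖ * ‖t j - x n j‖ := by
      rw [← inner_sub_right, sub_sub_sub_cancel_right]
      exact real_inner_le_norm _ _
    have h3 : (ε + l n j) / 2 * ‖t j - u n j‖ ^ 2 ≤ (ε + L) / 2 * ‖t j - u n j‖ ^ 2 := by
      have : (l n j : ℝ) ≤ L := hl n j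
      gcongr
    have h4 : 0 ≤ (ε + l n j) / 2 * ‖x n j - u n j‖ ^ 2 := by positivity
    linarith
  have hlow : ∀ a : ℝ, (a : EReal) < blockReg r i xs → ∀ᶠ n in atTop, a < regVal r i (x n) := by
    intro a ha
    filter_upwards [hx.eventually (hlsc xs (a : EReal) ha)] with n hn
    have hn' : (a : EReal) < blockReg r i (x n) := hn
    rwa [blockReg_eq_coe hr (hfin n), EReal.coe_lt_coe_iff] at hn'
  have hxs : ∀ j, r i j (xs j) ≠ ⊤ := by
    rw [← blockReg_ne_top_iff hr]
    intro htop
    obtain ⟨t, ht⟩ := hr.2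
    rw [blockReg_ne_top_iff hr] at ht
    set B := ∑ j, (‖Gs j‖ * ‖t j - xs j‖ + (ε + L) / 2 * ‖t j - xs j‖ ^ 2)
    have h1 := hlow (regVal r i t + (B + 1)) (by rw [htop]; exact EReal.coe_lt_top _)
    have h2 := (he t).eventually (gt_mem_nhds (lt_add_one B))
    obtain ⟨n, hn1, hn2⟩ := (h1.and h2).exists
    linarith [hup t ht n]
  refine ⟨hxs, tendsto_order.2 ⟨fun a ha => ?_, fun a ha => ?_⟩⟩
  · exact hlow a (by rw [blockReg_eq_coe hr hxs]; exact EReal.coe_lt_coe_iff.2 ha)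
  · have h1 := (he xs).const_add (regVal r i xs)
    simp only [sub_self, norm_zero, mul_zero, ne_eq, OfNat.ofNat_ne_zero, not_false_eq_true,
      zero_pow, add_zero, Finset.sum_const_zero] at h1
    filter_upwards [h1.eventually (gt_mem_nhds ha)] with n hn
    exact (hup xs hxs n).trans_lt hn

theorem sum_regVal_add_inner_le {r : (i : Fin N) → (j : Fin (R i)) → E i j → EReal} {C : ℝ}
    {X Y W : FullSpace E}
    (h : ∀ i j, (r i j (X i j)).toReal + inner ℝ (W i j) (Y i j - X i j)
      - C * ‖Y i j - X i j‖ ^ 2 ≤ (r i j (Y i j)).toReal) :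
    ∑ i, regVal r i (X i) + inner ℝ W (Y - X) - C * ‖Y - X‖ ^ 2 ≤ ∑ i, regVal r i (Y i) := by
  rw [PiLp.inner_apply, PiLp.norm_sq_eq_of_L2, Finset.mul_sum, ← Finset.sum_add_distrib,
    ← Finset.sum_sub_distrib]
  refine Finset.sum_le_sum fun i _ => ?_
  rw [PiLp.inner_apply, PiLp.norm_sq_eq_of_L2, Finset.mul_sum, regVal, regVal,
    ← Finset.sum_add_distrib, ← Finset.sum_sub_distrib]
  exact Finset.sum_le_sum fun j _ => h i j

variable [∀ i j, FiniteDimensional ℝ (E i j)]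

/-- Proximal subgradients of the regularizers add up with the gradient to a regular subgradient of
the objective. -/
theorem isRegularSubgradient_objective {f : FullSpace E → ℝ} (hf : Differentiable ℝ f)
    {r : (i : Fin N) → (j : Fin (R i)) → E i j → EReal} (hr : ∀ i, ProperFun (blockReg r i))
    {C : ℝ} {X W : FullSpace E} (hX : ∀ i j, r i j (X i j) ≠ ⊤)
    (h : ∀ i j t, r i j t ≠ ⊤ → (r i j (X i j)).toReal + inner ℝ (W i j) (t - X i j)
      - C * ‖t - X i j‖ ^ 2 ≤ (r i j t).toReal) :
    IsRegularSubgradient (objective f r) X (euclGrad f X + W) := by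
  refine ⟨objective_ne_bot hr f X, (objective_ne_top_iff hr f X).2 hX, fun δ hδ => ?_⟩
  have h1 := (hasFDerivAt_euclGrad (hf X)).isLittleO.def (half_pos hδ)
  have h2 : ∀ᶠ Y in 𝓝 X, C * ‖Y - X‖ < δ / 2 := by
    have : Tendsto (fun Y => C * ‖Y - X‖) (𝓝 X) (𝓝 (C * ‖X - X‖)) :=
      Continuous.tendsto (by fun_prop) X
    simp only [sub_self, norm_zero, mul_zero] at this
    exact this.eventually (gt_mem_nhds (half_pos hδ))
  filter_upwards [h1, h2] with Y hY1 hY2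
  by_cases hY : objective f r Y = ⊤
  · rw [hY]; exact le_top
  rw [← Ne, objective_ne_top_iff hr] at hY
  rw [objective_eq_coe hr f hX, objective_eq_coe hr f hY, ← EReal.coe_add, EReal.coe_le_coe_iff]
  have h3 := sum_regVal_add_inner_le (C := C) (W := W) fun i j => h i j (Y i j) (hY i j)
  rw [innerSL_apply_apply, Real.norm_eq_abs] at hY1
  have h4 := (abs_le.1 hY1).1
  have h5 := mul_le_mul_of_nonneg_right hY2.le (norm_nonneg (Y - X))
  rw [inner_add_left]
  nlinarith

/-- A common limit of proximal gradient steps, of their base points and of the points at which the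
partial gradients are evaluated is stationary. -/
theorem isStationaryPoint_of_proxSet {f : FullSpace E → ℝ} (hf : ContDiff ℝ 1 f)
    {r : (i : Fin N) → (j : Fin (R i)) → E i j → EReal} {ε : ℝ}
    (hε : 0 < ε) (hr : ∀ i, ProperFun (blockReg r i))
    (hlsc : ∀ i, LowerSemicontinuous (blockReg r i)) {L : ℝ≥0}
    {X : ℕ → FullSpace E} {Z : ℕ → Fin N → FullSpace E} {u : ℕ → ∀ i, Block E i}
    {Xs : FullSpace E} {l : ℕ → ∀ i, Fin (R i) → ℝ≥0}
    (hX : Tendsto X atTop (𝓝 Xs)) (hZ : ∀ i, Tendsto (fun n => Z n i) atTop (𝓝 Xs))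
    (hu : ∀ i, Tendsto (fun n => u n i) atTop (𝓝 (Xs i))) (hl : ∀ n i j, l n i j ≤ L)
    (hp : ∀ n i j, X n i j ∈ proxSet (r i j) (1 / (ε + l n i j))
      (u n i j - (1 / (ε + l n i j) : ℝ) •
        subBlockGrad f i j (setBlock (Z n i) i (subSplice j (X n i) (u n i))))) :
    IsStationaryPoint (objective f r) Xs := by
  let G : ℕ → ∀ i, (j : Fin (R i)) → E i j := fun n i j =>
    subBlockGrad f i j (setBlock (Z n i) i (subSplice j (X n i) (u n i)))
  have hG : ∀ i j, Tendsto (fun n => G n i j) atTop (𝓝 (euclGrad f Xs i j)) := by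
    intro i j
    have h1 := tendsto_setBlock (hZ i) (tendsto_subSplice (tendsto_block hX i) (hu i) j)
    exact tendsto_subBlock (tendsto_block (((continuous_euclGrad hf).tendsto Xs).comp h1) i) j
  have hfin : ∀ n i j, r i j (X n i j) ≠ ⊤ := fun n i j =>
    proxSet_ne_top ((hr i).exists_sub_ne_top j) (hp n i j)
  have hreg := fun i => tendsto_regVal_of_proxSet hε (hr i) (hlsc i) (tendsto_block hX i) (hu i)
    (hG i) (fun n => hl n i) (fun n => hp n i)
  have hXs : ∀ i j, r i j (Xs i j) ≠ ⊤ := fun i => (hreg i).1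
  let W : ℕ → FullSpace E := fun n => WithLp.toLp 2 fun i => WithLp.toLp 2 fun j =>
    -G n i j - (ε + l n i j : ℝ) • (X n i j - u n i j)
  have hW : Tendsto W atTop (𝓝 (-euclGrad f Xs)) := by
    refine tendsto_piLp fun i => tendsto_piLp fun j => ?_
    have h1 : Tendsto (fun n => X n i j - u n i j) atTop (𝓝 0) := by
      simpa using (tendsto_subBlock (tendsto_block hX i) j).sub (tendsto_subBlock (hu i) j)
    have h2 : Tendsto (fun n => (ε + l n i j : ℝ) • (X n i j - u n i j)) atTop (𝓝 0) := by
      refine squeeze_zero_norm (a := fun n => (ε + L) * ‖X n i j - u n i j‖) (fun n => ?_) ?_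
      · have : (l n i j : ℝ) ≤ L := hl n i j
        rw [norm_smul, Real.norm_eq_abs, abs_of_nonneg (by positivity)]
        gcongr
      · simpa using h1.norm.const_mul (ε + L : ℝ)
    simpa [W] using (hG i j).neg.sub h2
  refine ⟨objective_ne_bot hr f Xs, (objective_ne_top_iff hr f Xs).2 hXs, X,
    fun n => euclGrad f (X n) + W n, hX, ?_, fun n => ?_, ?_⟩
  · simp only [objective_eq_coe hr f hXs, fun n => objective_eq_coe hr f (hfin n)]
    exact (continuous_coe_real_ereal.tendsto _).comp
      (((hf.continuous.tendsto Xs).comp hX).add (tendsto_finsetSum _ fun i _ => (hreg i).2))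
  · refine isRegularSubgradient_objective (C := (ε + L) / 2) (hf.differentiable one_ne_zero) hr
      (hfin n) fun i j t ht => ?_
    have h1 := proxSet_step_subgradient (fun t => (hr i).sub_ne_bot j t)
      (by positivity) (hp n i j) (hfin n i j) ht
    have h2 : (ε + l n i j) / 2 * ‖t - X n i j‖ ^ 2 ≤ (ε + L) / 2 * ‖t - X n i j‖ ^ 2 := by
      have : (l n i j : ℝ) ≤ L := hl n i j
      gcongr
    simp only [W, G]
    linarith
  · simpa using (((continuous_euclGrad hf).tendsto Xs).comp hX).add hW

end Limits

/-! ### Real sequences -/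

section Sequences

theorem tendsto_zero_of_tendsto_sq {d : ℕ → ℝ} (h : Tendsto (fun k => d k ^ 2) atTop (𝓝 0)) :
    Tendsto d atTop (𝓝 0) := by
  have h1 : Tendsto (fun k => √(d k ^ 2)) atTop (𝓝 0) :=
    (Real.continuous_sqrt.tendsto' 0 0 Real.sqrt_zero).comp h
  simp only [Real.sqrt_sq_eq_abs] at h1
  exact (tendsto_zero_iff_abs_tendsto_zero d).2 h1

theorem tendsto_zero_of_sufficient_decrease {Φ d : ℕ → ℝ} {b c : ℝ} (hc : 0 < c)
    (h : ∀ k, Φ (k + 1) + c * d k ^ 2 ≤ Φ k) (hb : ∀ k, b ≤ Φ k) :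
    Tendsto d atTop (𝓝 0) ∧ Tendsto (fun k => Φ k - Φ (k + 1)) atTop (𝓝 0) := by
  have hanti : Antitone Φ := antitone_nat_of_succ_le fun k => by
    have := h k
    nlinarith [mul_nonneg hc.le (sq_nonneg (d k))]
  have hlim := tendsto_atTop_ciInf hanti ⟨b, by rintro _ ⟨k, rfl⟩; exact hb k⟩
  have hdiff : Tendsto (fun k => Φ k - Φ (k + 1)) atTop (𝓝 0) := by
    simpa using hlim.sub (hlim.comp (tendsto_add_atTop_nat 1))
  refine ⟨?_, hdiff⟩
  have hsq : Tendsto (fun k => d k ^ 2) atTop (𝓝 0) := by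
    refine squeeze_zero (g := fun k => c⁻¹ * (Φ k - Φ (k + 1))) (fun k => sq_nonneg _)
      (fun k => ?_) (by simpa using hdiff.const_mul c⁻¹)
    rw [le_inv_mul_iff₀ hc]
    linarith [h k]
  exact tendsto_zero_of_tendsto_sq hsq

theorem tendsto_zero_of_le_contraction {d e : ℕ → ℝ} {γ : ℝ} (hγ0 : 0 ≤ γ) (hγ1 : γ < 1)
    (hd : Tendsto d atTop (𝓝 0)) (he : ∀ k, 0 ≤ e k) (h : ∀ k, e (k + 1) ≤ γ * (d k + e k)) :
    Tendsto e atTop (𝓝 0) := by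
  refine tendsto_order.2 ⟨fun a ha => Eventually.of_forall fun k => ha.trans_le (he k),
    fun η hη => ?_⟩
  have hδ : 0 < (1 - γ) * (η / 2) := by
    have : 0 < 1 - γ := by linarith
    positivity
  obtain ⟨K, hK⟩ := eventually_atTop.1 (hd.eventually (gt_mem_nhds hδ))
  have hrec : ∀ n, e (n + K) ≤ γ ^ n * e K + η / 2 := by
    intro n
    induction n with
    | zero => simp; positivity
    | succ n ih =>
      have h1 := h (n + K)
      have h2 := hK (n + K) (by omega)
      have h3 : γ * (d (n + K) + e (n + K))
          ≤ γ * ((1 - γ) * (η / 2) + (γ ^ n * e K + η / 2)) := by gcongr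
      have h4 : γ * ((1 - γ) * (η / 2)) ≤ (1 - γ) * (η / 2) := mul_le_of_le_one_left hδ.le hγ1.le
      rw [show n + 1 + K = n + K + 1 by omega, pow_succ]
      nlinarith
  have hpow : Tendsto (fun n => γ ^ n * e K) atTop (𝓝 0) := by
    simpa using (tendsto_pow_atTop_nhds_zero_of_lt_one hγ0 hγ1).mul_const (e K)
  rw [← eventually_map (f := atTop) (m := e) (P := fun b => b < η), ← map_add_atTop_eq_nat K,
    map_map, eventually_map]
  filter_upwards [hpow.eventually (gt_mem_nhds (half_pos hη))] with n hn
  exact (hrec n).trans_lt (by linarith)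

end Sequences

/-! ### The double-loop method -/

section DoubleLoop

variable {N : ℕ} {R : Fin N → ℕ} {E : (i : Fin N) → Fin (R i) → Type u}

open Classical in
/-- The point whose blocks are frozen in the call that produced `X_i^{k+1}`. -/
noncomputable def frozenPoint (P : ℕ → Prop) (X Xbar Xtil : ℕ → FullSpace E) (k : ℕ)
    (i : Fin N) : FullSpace E :=
  if P k then splice i (X (k + 1)) (X k) else splice i (Xtil k) (Xbar k)

variable [∀ i j, NormedAddCommGroup (E i j)]
  {f : FullSpace E → ℝ} {r : (i : Fin N) → (j : Fin (R i)) → E i j → EReal}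
  {ℓ : (i : Fin N) → ((p : {p : Fin N // p ≠ i}) → Block E p.1) → ℝ≥0}
  {ε : ℝ} {m : Fin N → ℕ} {w : ℕ → ℝ} {X Xbar Y Xtil : ℕ → FullSpace E}

theorem frozenBlocks_eq (k : ℕ) (i : Fin N) : frozenBlocks f r ε m X Xbar Y Xtil k i
    = others i (frozenPoint (fun k => SafeguardTest f r (tauParam ε m) (X k) (Y k))
      X Xbar Xtil k i) := by
  unfold frozenBlocks frozenPoint
  split_ifs <;> rfl

variable [∀ i j, InnerProductSpace ℝ (E i j)] [∀ i j, FiniteDimensional ℝ (E i j)]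

theorem IsDoubleLoopRun.isSubBCPGD (h : IsDoubleLoopRun f r ℓ ε m w X Xbar Y Xtil) (k : ℕ)
    (i : Fin N) : IsSubBCPGD f r ℓ ε (m i) i
      (frozenPoint (fun k => SafeguardTest f r (tauParam ε m) (X k) (Y k)) X Xbar Xtil k i)
      (X k i) (X (k + 1) i) := by
  unfold frozenPoint
  split_ifs with hP
  · exact (h.safeguard k hP i).1
  · rw [(h.accept k hP).1]
    exact h.trial k i

theorem IsDoubleLoopRun.extrapolated_eq (h : IsDoubleLoopRun f r ℓ ε m w X Xbar Y Xtil) (k : ℕ) :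
    Xbar (k + 1) = X (k + 1) + w k • (X (k + 1) - Xbar k) := by
  ext1 i
  by_cases hP : SafeguardTest f r (tauParam ε m) (X k) (Y k)
  · exact (h.safeguard k hP i).2
  · rw [(h.accept k hP).1, (h.accept k hP).2]
    exact h.extrapolate k i

theorem norm_frozenPoint_sub_le (h : IsDoubleLoopRun f r ℓ ε m w X Xbar Y Xtil) (k : ℕ)
    (i p : Fin N) (a : Block E p) :
    ‖frozenPoint (fun k => SafeguardTest f r (tauParam ε m) (X k) (Y k)) X Xbar Xtil k i p - a‖
      ≤ ‖X (k + 1) p - a‖ + ‖X k p - a‖ + ‖Xbar (k + 1) p - a‖ + ‖Xbar k p - a‖ := by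
  have h1 := norm_nonneg (X (k + 1) p - a)
  have h2 := norm_nonneg (X k p - a)
  have h3 := norm_nonneg (Xbar (k + 1) p - a)
  have h4 := norm_nonneg (Xbar k p - a)
  unfold frozenPoint
  split_ifs with hP
  · by_cases hp : p < i <;> simp only [splice, hp, if_true, if_false] <;> linarith
  · rw [← (h.accept k hP).2]
    by_cases hp : p < i <;> simp only [splice, hp, if_true, if_false] <;> linarith

/-- Sufficient decrease of the (finite) objective along a run. -/
theorem IsDoubleLoopRun.decrease (h : IsDoubleLoopRun f r ℓ ε m w X Xbar Y Xtil)
    (hr : ∀ i, ProperFun (blockReg r i)) {c : ℝ}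
    (hdec : ∀ k, (∀ i j, r i j (X k i j) ≠ ⊤) → ∀ i,
      let Z := frozenPoint (fun k => SafeguardTest f r (tauParam ε m) (X k) (Y k)) X Xbar Xtil k i
      f (setBlock Z i (X (k + 1) i)) + regVal r i (X (k + 1) i)
        + c * ‖X (k + 1) i - X k i‖ ^ 2 ≤ f (setBlock Z i (X k i)) + regVal r i (X k i))
    (k : ℕ) (hk : ∀ i j, r i j (X k i j) ≠ ⊤) (hk' : ∀ i j, r i j (X (k + 1) i j) ≠ ⊤) :
    f (X (k + 1)) + ∑ i, regVal r i (X (k + 1) i)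
      + min c (tauParam ε m / 2) * ‖X (k + 1) - X k‖ ^ 2 ≤ f (X k) + ∑ i, regVal r i (X k i) := by
  by_cases hP : SafeguardTest f r (tauParam ε m) (X k) (Y k)
  · have h1 : ∀ i, (f (setBlock (splice i (X (k + 1)) (X k)) i (X (k + 1) i))
        - f (splice i (X (k + 1)) (X k))) + regVal r i (X (k + 1) i)
        + c * ‖(X (k + 1) - X k) i‖ ^ 2 ≤ regVal r i (X k i) := by
      intro i
      have h2 := hdec k hk i
      have e : setBlock (splice i (X (k + 1)) (X k)) i (X k i) = splice i (X (k + 1)) (X k) := by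
        conv_lhs => rw [← splice_self i (X (k + 1)) (X k)]
        exact setBlock_eq_self _ _
      simp only [frozenPoint, hP, if_true, e] at h2
      rw [PiLp.sub_apply]
      linarith
    have hs := Finset.sum_le_sum fun i (_ : i ∈ Finset.univ) => h1 i
    rw [Finset.sum_add_distrib, Finset.sum_add_distrib, ← Finset.mul_sum, sum_setBlock_splice,
      ← PiLp.norm_sq_eq_of_L2] at hs
    have := mul_le_mul_of_nonneg_right (min_le_left c (tauParam ε m / 2))
      (sq_nonneg ‖X (k + 1) - X k‖)
    linarith
  · have h1 := hP
    rw [SafeguardTest, not_lt, ← (h.accept k hP).1, objective_eq_coe hr f hk,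
      objective_eq_coe hr f hk', ← EReal.coe_sub, EReal.coe_le_coe_iff] at h1
    have := mul_le_mul_of_nonneg_right (min_le_right c (tauParam ε m / 2))
      (sq_nonneg ‖X (k + 1) - X k‖)
    linarith

end DoubleLoop

theorem mainTheorem3 {N : ℕ} {R : Fin N → ℕ} {E : (i : Fin N) → Fin (R i) → Type u}
    [∀ i j, NormedAddCommGroup (E i j)] [∀ i j, InnerProductSpace ℝ (E i j)]
    [∀ i j, FiniteDimensional ℝ (E i j)]
    -- the problem: `f` smooth, each `r_i = ∑_j r_{i,j}` proper and lower semicontinuous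
    (f : FullSpace E → ℝ) (r : (i : Fin N) → (j : Fin (R i)) → E i j → EReal)
    (hf : ContDiff ℝ 1 f)
    (hr_proper : ∀ i, ProperFun (blockReg r i))
    (hr_lsc : ∀ i, LowerSemicontinuous (blockReg r i))
    -- lower boundedness
    (hf_bdd : BddBelow (Set.range f))
    (hr_bdd : ∀ i, ∃ c : ℝ, ∀ x : Block E i, (c : EReal) ≤ blockReg r i x)
    -- blockwise global Lipschitz continuity of the partial gradients
    (ℓ : (i : Fin N) → ((p : {p : Fin N // p ≠ i}) → Block E p.1) → ℝ≥0)
    (hℓ : HasBlockLipschitzModuli f ℓ)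
    -- the gradient is Lipschitz continuous on bounded sets
    (hf_lip : ∀ S : Set (FullSpace E), Bornology.IsBounded S →
      ∃ M : ℝ, 0 < M ∧ ∀ x ∈ S, ∀ y ∈ S, ‖euclGrad f x - euclGrad f y‖ ≤ M * ‖x - y‖)
    -- the parameters and a run of the algorithm
    (ε : ℝ) (hε : 0 < ε) (m : Fin N → ℕ) (hm : ∀ i, 0 < m i)
    (w : ℕ → ℝ) (γ : ℝ) (hw_mono : Monotone w) (hw_pos : ∀ k, 0 < w k)
    (hγ : IsLUB (Set.range w) γ) (hγ_lt : γ < 1)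
    (X Xbar Y Xtil : ℕ → FullSpace E)
    (hrun : IsDoubleLoopRun f r ℓ ε m w X Xbar Y Xtil)
    -- the moduli met along the run are uniformly bounded
    (hℓ_bdd : ∀ i, ∃ lplus : ℝ≥0, ∀ k, ℓ i (frozenBlocks f r ε m X Xbar Y Xtil k i) ≤ lplus) :
    ∀ Xstar : FullSpace E, MapClusterPt Xstar atTop X → IsStationaryPoint (objective f r) Xstar := by
  intro Xs hXs
  rcases isEmpty_or_nonempty (Fin N) with hN | hN
  · exact isStationaryPoint_of_proxSet hf hε hr_proper hr_lsc (L := 0) (X := fun _ => Xs)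
      (Z := fun _ _ => Xs) (u := fun _ i => Xs i) (l := fun _ _ _ => 0) tendsto_const_nhds
      isEmptyElim isEmptyElim (fun _ => isEmptyElim) (fun _ => isEmptyElim)
  set Z := frozenPoint (fun k => SafeguardTest f r (tauParam ε m) (X k) (Y k)) X Xbar Xtil
  set M : ℕ := Finset.univ.sup m
  have hmM : ∀ i, m i ≤ M := fun i => Finset.le_sup (Finset.mem_univ i)
  have hM0 : 0 < M := (hm hN.some).trans_le (hmM _)
  set c : ℝ := ε / (4 * (M + 1)) with hc
  have hc0 : 0 < c := by positivity
  have hcm : ∀ i, c * (4 * (m i + 1)) ≤ ε := by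
    intro i
    have h1 : (m i : ℝ) ≤ M := by exact_mod_cast hmM i
    rw [hc, div_mul_eq_mul_div, div_le_iff₀ (by positivity)]
    gcongr
  have hτ : 0 < tauParam ε m := div_pos hε (by exact_mod_cast hM0)
  choose lp hlp using hℓ_bdd
  have hsub := fun k i => (hrun.isSubBCPGD k i).exists_last_step (hf.differentiable one_ne_zero)
    hε hc0.le (hcm i) (hr_proper i)
  have hfin : ∀ k i j, r i j (X (k + 1) i j) ≠ ⊤ := fun k i => (hsub k i).1
  choose u l hprox hdec using fun k i => (hsub k i).2
  -- decrease of the objective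
  let Φ : ℕ → ℝ := fun k => f (X k) + ∑ i, regVal r i (X k i)
  obtain ⟨bf, hbf⟩ := hf_bdd
  choose br hbr using hr_bdd
  have hΦb : ∀ k, bf + ∑ i, br i ≤ Φ (k + 1) := by
    intro k
    refine add_le_add (hbf ⟨_, rfl⟩) (Finset.sum_le_sum fun i _ => ?_)
    have := hbr i (X (k + 1) i)
    rwa [blockReg_eq_coe (hr_proper i) (hfin k i), EReal.coe_le_coe_iff] at this
  have hΦ := tendsto_zero_of_sufficient_decrease (Φ := fun k => Φ (k + 1))
    (d := fun k => ‖X (k + 1 + 1) - X (k + 1)‖) (lt_min hc0 (half_pos hτ))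
    (fun k => hrun.decrease hr_proper (fun k hk i => by
      have h1 := hdec k i (hk i)
      have h2 : 0 ≤ c * ‖X (k + 1) i - u k i‖ ^ 2 := by positivity
      linarith) (k + 1) (hfin k) (hfin (k + 1))) hΦb
  have hd : Tendsto (fun k => ‖X (k + 1) - X k‖) atTop (𝓝 0) :=
    (tendsto_add_atTop_iff_nat 1).1 hΦ.1
  have hΔ : Tendsto (fun k => Φ k - Φ (k + 1)) atTop (𝓝 0) :=
    (tendsto_add_atTop_iff_nat 1).1 hΦ.2
  -- the extrapolated points approach the iterates
  have hwγ : ∀ k, w k ≤ γ := fun k => hγ.1 ⟨k, rfl⟩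
  have hγ0 : 0 ≤ γ := (hw_pos 0).le.trans (hwγ 0)
  have he : Tendsto (fun k => ‖Xbar k - X k‖) atTop (𝓝 0) := by
    refine tendsto_zero_of_le_contraction hγ0 hγ_lt hd (fun k => norm_nonneg _) fun k => ?_
    rw [hrun.extrapolated_eq k, add_sub_cancel_left, norm_smul, Real.norm_eq_abs,
      abs_of_pos (hw_pos k)]
    have h1 : ‖X (k + 1) - Xbar k‖ ≤ ‖X (k + 1) - X k‖ + ‖Xbar k - X k‖ := by
      rw [norm_sub_rev (Xbar k)]
      exact norm_sub_le_norm_sub_add_norm_sub _ _ _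
    exact mul_le_mul (hwγ k) h1 (norm_nonneg _) hγ0
  -- a convergent subsequence avoiding the starting point
  obtain ⟨ψ, hψ, hXψ'⟩ := hXs.tendsto_subseq
  let φ : ℕ → ℕ := fun n => ψ (n + 1)
  have hφ : Tendsto φ atTop atTop := hψ.tendsto_atTop.comp (tendsto_add_atTop_nat 1)
  have hφ1 : ∀ n, ∃ k, φ n = k + 1 := fun n =>
    ⟨φ n - 1, by have := hψ.id_le (n + 1); simp only [id, φ] at *; omega⟩
  have hX0 : Tendsto (fun n => X (φ n)) atTop (𝓝 Xs) := hXψ'.comp (tendsto_add_atTop_nat 1)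
  have hX1 : Tendsto (fun n => X (φ n + 1)) atTop (𝓝 Xs) := by
    simpa using hX0.add (tendsto_zero_iff_norm_tendsto_zero.2 (hd.comp hφ))
  have hB0 : Tendsto (fun n => Xbar (φ n)) atTop (𝓝 Xs) := by
    simpa using hX0.add (tendsto_zero_iff_norm_tendsto_zero.2 (he.comp hφ))
  have hB1 : Tendsto (fun n => Xbar (φ n + 1)) atTop (𝓝 Xs) := by
    simpa using hX1.add (tendsto_zero_iff_norm_tendsto_zero.2
      (he.comp ((tendsto_add_atTop_nat 1).comp hφ)))
  have hZt : ∀ i, Tendsto (fun n => Z (φ n) i) atTop (𝓝 Xs) := by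
    intro i
    refine tendsto_piLp fun p => tendsto_iff_norm_sub_tendsto_zero.2 ?_
    refine squeeze_zero (fun n => norm_nonneg _)
      (fun n => norm_frozenPoint_sub_le hrun (φ n) i p (Xs p)) ?_
    have hn : ∀ {x : ℕ → FullSpace E}, Tendsto x atTop (𝓝 Xs) →
        Tendsto (fun n => ‖x n p - Xs p‖) atTop (𝓝 0) := fun hx =>
      tendsto_iff_norm_sub_tendsto_zero.1 (tendsto_block hx p)
    simpa using (((hn hX1).add (hn hX0)).add (hn hB1)).add (hn hB0)
  -- the last inner steps vanish along the subsequence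
  have hsum : Tendsto (fun n => ∑ i, (f (setBlock (Z (φ n) i) i (X (φ n) i))
      - f (setBlock (Z (φ n) i) i (X (φ n + 1) i))) + (Φ (φ n) - Φ (φ n + 1))
      - (f (X (φ n)) - f (X (φ n + 1)))) atTop (𝓝 0) := by
    have hfc : ∀ {x : ℕ → FullSpace E}, Tendsto x atTop (𝓝 Xs) →
        Tendsto (fun n => f (x n)) atTop (𝓝 (f Xs)) := fun hx =>
      (hf.continuous.tendsto Xs).comp hx
    have h1 := tendsto_finsetSum Finset.univ fun i (_ : i ∈ Finset.univ) =>
      (hfc (tendsto_setBlock (hZt i) (tendsto_block hX0 i))).sub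
        (hfc (tendsto_setBlock (hZt i) (tendsto_block hX1 i)))
    simpa using (h1.add (hΔ.comp hφ)).sub ((hfc hX0).sub (hfc hX1))
  have hu : ∀ i, Tendsto (fun n => u (φ n) i) atTop (𝓝 (Xs i)) := by
    intro i
    have hsq : Tendsto (fun n => ‖X (φ n + 1) i - u (φ n) i‖ ^ 2) atTop (𝓝 0) := by
      refine squeeze_zero (fun n => sq_nonneg _) (fun n => ?_)
        ((hsum.const_mul c⁻¹).trans (by rw [mul_zero]))
      rw [le_inv_mul_iff₀ hc0]
      obtain ⟨k, hk⟩ := hφ1 n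
      have h1 : ∀ p, c * ‖X (φ n + 1) p - u (φ n) p‖ ^ 2
          ≤ (f (setBlock (Z (φ n) p) p (X (φ n) p)) - f (setBlock (Z (φ n) p) p (X (φ n + 1) p)))
            + (regVal r p (X (φ n) p) - regVal r p (X (φ n + 1) p)) := by
        intro p
        have h2 := hdec (φ n) p (by rw [hk]; exact hfin k p)
        have h3 : 0 ≤ c * ‖X (φ n + 1) p - X (φ n) p‖ ^ 2 := by positivity
        linarith
      have h4 := Finset.sum_le_sum fun p (_ : p ∈ Finset.univ) => h1 p
      have h5 := Finset.single_le_sum (f := fun p => c * ‖X (φ n + 1) p - u (φ n) p‖ ^ 2)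
        (fun p _ => by positivity) (Finset.mem_univ i)
      rw [Finset.sum_add_distrib, Finset.sum_sub_distrib (f := fun p => regVal r p (X (φ n) p))]
        at h4
      simp only [Φ]
      linarith
    simpa using (tendsto_block hX1 i).sub
      (tendsto_zero_iff_norm_tendsto_zero.2 (tendsto_zero_of_tendsto_sq hsq))
  refine isStationaryPoint_of_proxSet hf hε hr_proper hr_lsc (L := Finset.univ.sup lp)
    (l := fun n i => l (φ n) i) hX1 hZt hu (fun n i j => ?_) (fun n i j => (hprox (φ n) i j).2)
  refine ((hprox (φ n) i j).1.trans ?_).trans (Finset.le_sup (Finset.mem_univ i))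
  rw [← frozenBlocks_eq]
  exact hlp i (φ n)
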